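/- Let $d$ be a natural number and let $H$ be a complex Hilbert space. A $d$-dimensional coordinate system on $H$ is a spectral measure $E$ on $\mathbb{R}^d$, i.e. a map from the Borel subsets of $\mathbb{R}^d$ to orthogonal projections in $B(H)$ which is countably additive (in the strong operator topology) and satisfies $E(\mathbb{R}^d)=1$. For $\xi\in H$ put $\mu_\xi(\Omega)=\langle E(\Omega)\xi,\xi\rangle$, a Borel measure on $\mathbb{R}^d$, and for $k\in\mathbb{R}^d$ let $v_E(k)=\int_{\mathbb{R}^d} e^{i x\cdot k}\,dE(x)$, a unitary operator. A $d$-dimensional discrete-time quantum walk is a triple $(H,(U^t)_{t\in\mathbb{Z}},E)$, where $U$ is a unitary operator on $H$. It is called smooth if for every $t\in\mathbb{Z}$ the map $\mathbb{R}^d\ni k\mapsto v_E(k)\,U^t\,v_E(-k)\in B(H)$ is infinitely differentiable with respect to the operator norm. For a unit vector $\xi\in H$ and an integer $t\ge 1$, let $\nu_{U,t,\xi}(\Omega)=\mu_{U^t\xi}(t\Omega)$, i.e. the push-forward of $\mu_{U^t\xi}$ along $x\mapsto x/t$. **Theorem.** Let $(H,(U^t)_{t\in\mathbb{Z}},E)$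 be a $d$-dimensional discrete-time smooth quantum walk. Then there exists a bounded closed subset $\Omega\subset\mathbb{R}^d$ such that for every unit vector $\xi\in H$, $$\lim_{t\to\infty}\nu_{U,t,\xi}(\Omega)=1 .$$ -/

import Mathlib

open MeasureTheory Filter Topology
open scoped ContDiff ENNReal

/-- A spectral (projection-valued) measure on a measurable space `X` acting on the complex Hilbert
space `H`: a countably additive map (in the strong operator topology) from measurable sets to
orthogonal projections, with `E X = 1`. The values on non-measurable sets are irrelevant. -/
structure SpectralMeasure (X : Type*) [MeasurableSpace X] (H : Type*) [NormedAddCommGroup H]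
    [InnerProductSpace ℂ H] [CompleteSpace H] where
  /-- The projection associated with a set. -/
  proj : Set X → (H →L[ℂ] H)
  isStarProjection_proj : ∀ s, MeasurableSet s → IsStarProjection (proj s)
  proj_univ : proj Set.univ = 1
  hasSum_proj : ∀ f : ℕ → Set X, (∀ n, MeasurableSet (f n)) →
    Pairwise (Function.onFun Disjoint f) →
    ∀ ξ : H, HasSum (fun n => proj (f n) ξ) (proj (⋃ n, f n) ξ)

namespace SpectralMeasure

section General

variable {X : Type*} [MeasurableSpace X] {H : Type*} [NormedAddCommGroup H]
  [InnerProductSpace ℂ H] [CompleteSpace H] (E : SpectralMeasure X H)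

theorem proj_empty : E.proj ∅ = 0 := by
  ext ξ
  have h := E.hasSum_proj (fun _ => ∅) (fun _ => MeasurableSet.empty)
    (fun _ _ _ => disjoint_bot_left) ξ
  simpa using tendsto_nhds_unique tendsto_const_nhds h.summable.tendsto_atTop_zero

theorem re_inner_proj (s : Set X) (hs : MeasurableSet s) (ξ : H) :
    (inner ℂ ξ (E.proj s ξ)).re = ‖E.proj s ξ‖ ^ 2 := by
  have hp := E.isStarProjection_proj s hs
  have h1 : E.proj s (E.proj s ξ) = E.proj s ξ := by
    rw [← mul_apply_eq_comp, hp.isIdempotentElem.eq]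
  have h2 := hp.isSelfAdjoint.isSymmetric ξ (E.proj s ξ)
  simp only [ContinuousLinearMap.coe_coe, h1] at h2
  rw [← h2, inner_self_eq_norm_sq_to_K]
  norm_cast

theorem inner_proj (s : Set X) (hs : MeasurableSet s) (ξ : H) :
    inner ℂ ξ (E.proj s ξ) = ((inner ℂ ξ (E.proj s ξ)).re : ℂ) := by
  have h2 := (E.isStarProjection_proj s hs).isSelfAdjoint.isSymmetric ξ ξ
  simp only [ContinuousLinearMap.coe_coe] at h2
  rw [eq_comm, ← Complex.conj_eq_iff_re, inner_conj_symm, h2]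

/-- The measure `μ_ξ(Ω) = ⟨E(Ω) ξ, ξ⟩` (the inner product of Mathlib is linear in the second
variable). -/
noncomputable def vecMeasure (ξ : H) : Measure X :=
  Measure.ofMeasurable (fun s _ => ENNReal.ofReal (inner ℂ ξ (E.proj s ξ)).re)
    (by simp [E.proj_empty])
    (by
      intro f hf hd
      have h := (E.hasSum_proj f hf hd ξ).mapL (innerSL ℂ ξ)
      have h' := Complex.hasSum_re h
      simp only [innerSL_apply_apply] at h'
      rw [← h'.tsum_eq, ENNReal.ofReal_tsum_of_nonneg _ h'.summable]
      intro n
      rw [E.re_inner_proj _ (hf n)]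
      positivity)

theorem vecMeasure_apply (ξ : H) (s : Set X) (hs : MeasurableSet s) :
    E.vecMeasure ξ s = ENNReal.ofReal (inner ℂ ξ (E.proj s ξ)).re :=
  Measure.ofMeasurable_apply s hs

theorem vecMeasure_univ (ξ : H) : E.vecMeasure ξ Set.univ = ENNReal.ofReal (‖ξ‖ ^ 2) := by
  rw [E.vecMeasure_apply ξ _ MeasurableSet.univ, E.re_inner_proj _ MeasurableSet.univ,
    E.proj_univ, one_apply_eq_self]

instance isFiniteMeasure_vecMeasure (ξ : H) : IsFiniteMeasure (E.vecMeasure ξ) :=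
  ⟨by rw [E.vecMeasure_univ]; exact ENNReal.ofReal_lt_top⟩

theorem real_vecMeasure (ξ : H) (s : Set X) (hs : MeasurableSet s) :
    (E.vecMeasure ξ).real s = (inner ℂ ξ (E.proj s ξ)).re := by
  rw [Measure.real, E.vecMeasure_apply ξ s hs, ENNReal.toReal_ofReal]
  rw [E.re_inner_proj s hs]
  positivity

theorem real_vecMeasure_univ (ξ : H) : (E.vecMeasure ξ).real Set.univ = ‖ξ‖ ^ 2 := by
  rw [Measure.real, E.vecMeasure_univ, ENNReal.toReal_ofReal (by positivity)]

/-- `T = ∫ f dE` in the weak sense: `⟨T ξ, ξ⟩ = ∫ f dμ_ξ` for every vector `ξ`. -/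
def IsIntegral (f : X → ℂ) (T : H →L[ℂ] H) : Prop :=
  ∀ ξ : H, inner ℂ ξ (T ξ) = ∫ x, f x ∂(E.vecMeasure ξ)

variable {E}

theorem IsIntegral.unique {f : X → ℂ} {S T : H →L[ℂ] H} (hS : E.IsIntegral f S)
    (hT : E.IsIntegral f T) : S = T := by
  apply ContinuousLinearMap.coe_injective
  rw [← ext_inner_map]
  intro x
  simp only [ContinuousLinearMap.coe_coe]
  rw [← inner_conj_symm, hS x, ← hT x, inner_conj_symm]

theorem norm_le_of_inner_le {T : H →L[ℂ] H} {w : ℝ} (hw : 0 ≤ w)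
    (h : ∀ ξ : H, ‖inner ℂ ξ (T ξ)‖ ≤ w * ‖ξ‖ ^ 2) : ‖T‖ ≤ 2 * w := by
  apply ContinuousLinearMap.opNorm_le_of_unit_norm (by positivity)
  intro x hx
  have h' : ∀ ξ : H, ‖inner ℂ (T ξ) ξ‖ ≤ w * ‖ξ‖ ^ 2 := fun ξ => by
    rw [norm_inner_symm]; exact h ξ
  by_cases hTx : T x = 0
  · rw [hTx, norm_zero]; positivity
  have hn : ‖T x‖ ≠ 0 := norm_ne_zero_iff.mpr hTx
  set y : H := ((‖T x‖⁻¹ : ℝ) : ℂ) • T x with hy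
  have hy1 : ‖y‖ = 1 := by
    rw [hy, norm_smul, Complex.norm_real, norm_inv, norm_norm, inv_mul_cancel₀ hn]
  have hin : inner ℂ (T x) y = ((‖T x‖ : ℝ) : ℂ) := by
    rw [hy, inner_smul_right, inner_self_eq_norm_sq_to_K]
    push_cast
    have : ((‖T x‖ : ℝ) : ℂ) ≠ 0 := by exact_mod_cast hn
    field_simp
    rfl
  have key := inner_map_polarization' (T : H →ₗ[ℂ] H) x y
  simp only [ContinuousLinearMap.coe_coe] at key
  rw [hin] at key
  have e1 := parallelogram_law_with_norm ℂ x y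
  have e2 := parallelogram_law_with_norm ℂ x (Complex.I • y)
  have hIy : ‖Complex.I • y‖ = 1 := by rw [norm_smul, Complex.norm_I, one_mul, hy1]
  rw [hx, hy1] at e1
  rw [hx, hIy] at e2
  have b1 := h' (x + y)
  have b2 := h' (x - y)
  have b3 := h' (x + Complex.I • y)
  have b4 := h' (x - Complex.I • y)
  have hk := congrArg norm key
  rw [Complex.norm_real, norm_norm, norm_div] at hk
  rw [hk]
  have t : ∀ a b c d : ℂ, ‖a - b - Complex.I * c + Complex.I * d‖ ≤ ‖a‖ + ‖b‖ + ‖c‖ + ‖d‖ := by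
    intro a b c d
    have i1 := norm_add_le (a - b - Complex.I * c) (Complex.I * d)
    have i2 := norm_sub_le (a - b) (Complex.I * c)
    have i3 := norm_sub_le a b
    rw [norm_mul, Complex.norm_I, one_mul] at i1 i2
    linarith
  have t' := t (inner ℂ (T (x + y)) (x + y)) (inner ℂ (T (x - y)) (x - y))
    (inner ℂ (T (x + Complex.I • y)) (x + Complex.I • y))
    (inner ℂ (T (x - Complex.I • y)) (x - Complex.I • y))
  rw [div_le_iff₀ (by norm_num)]
  have h4 : ‖(4 : ℂ)‖ = 4 := by norm_num
  rw [h4]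
  nlinarith

variable (E)

theorem integrable_of_bounded {f : X → ℂ} (hf : Measurable f) {C : ℝ} (hC : ∀ x, ‖f x‖ ≤ C)
    (ξ : H) : Integrable f (E.vecMeasure ξ) :=
  Integrable.of_bound hf.aestronglyMeasurable C (Eventually.of_forall hC)

theorem norm_integral_le {f : X → ℂ} {C : ℝ} (hC : ∀ x, ‖f x‖ ≤ C) (ξ : H) :
    ‖∫ x, f x ∂(E.vecMeasure ξ)‖ ≤ C * ‖ξ‖ ^ 2 := by
  have h := norm_integral_le_of_norm_le_const (μ := E.vecMeasure ξ) (Eventually.of_forall hC)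
  rwa [E.real_vecMeasure_univ] at h

theorem exists_isIntegral_simpleFunc (g : SimpleFunc X ℂ) : ∃ T, E.IsIntegral g T := by
  refine ⟨∑ c ∈ g.range, c • E.proj (g ⁻¹' {c}), fun ξ => ?_⟩
  obtain ⟨C, hC⟩ := g.exists_forall_norm_le
  rw [g.integral_eq_sum (E.integrable_of_bounded g.measurable hC ξ)]
  simp only [sum_apply, smul_apply, inner_sum,
    inner_smul_right]
  refine Finset.sum_congr rfl fun c _ => ?_
  rw [E.real_vecMeasure ξ _ (g.measurableSet_fiber c), E.inner_proj _ (g.measurableSet_fiber c),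
    Complex.real_smul, Complex.ofReal_re, mul_comm]

theorem exists_simpleFunc_near {f : X → ℂ} (hf : Measurable f) {C : ℝ} (hC : ∀ x, ‖f x‖ ≤ C)
    {ε : ℝ} (hε : 0 < ε) : ∃ g : SimpleFunc X ℂ, ∀ x, ‖g x - f x‖ ≤ ε := by
  obtain ⟨t, ht, hcov⟩ := Metric.totallyBounded_iff.mp
    (isCompact_closedBall (0 : ℂ) C).totallyBounded ε hε
  obtain ⟨l, hl⟩ := ht.exists_finset_coe
  let e : ℕ → ℂ := fun n => l.toList.getD n 0
  refine ⟨(SimpleFunc.nearestPt e l.toList.length).comp f hf, fun x => ?_⟩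
  have hx : f x ∈ Metric.closedBall (0 : ℂ) C := by simpa using hC x
  obtain ⟨y, hy, hxy⟩ := Set.mem_iUnion₂.mp (hcov hx)
  have hy' : y ∈ l.toList := by
    rw [Finset.mem_toList]; rw [← hl] at hy; exact_mod_cast hy
  obtain ⟨n, hn, hny⟩ := List.getElem_of_mem hy'
  have he : e n = y := by
    simp only [e]
    rw [List.getD_eq_getElem _ _ hn, hny]
  have h1 := SimpleFunc.edist_nearestPt_le e (f x) hn.le
  rw [he, edist_dist, edist_dist, ENNReal.ofReal_le_ofReal_iff dist_nonneg] at h1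
  rw [SimpleFunc.coe_comp, Function.comp_apply, ← dist_eq_norm]
  have h2 : dist (f x) y < ε := hxy
  rw [dist_comm] at h2
  linarith

/-- Every bounded measurable function can be integrated against a spectral measure. -/
theorem exists_isIntegral {f : X → ℂ} (hf : Measurable f) (hb : ∃ C : ℝ, ∀ x, ‖f x‖ ≤ C) :
    ∃ T, E.IsIntegral f T := by
  obtain ⟨C, hC⟩ := hb
  choose g hg using fun n : ℕ =>
    exists_simpleFunc_near hf hC (Nat.one_div_pos_of_nat (α := ℝ) (n := n))
  choose T hT using fun n => E.exists_isIntegral_simpleFunc (g n)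
  have hint : ∀ n ξ, Integrable (g n) (E.vecMeasure ξ) := fun n ξ => by
    obtain ⟨D, hD⟩ := (g n).exists_forall_norm_le
    exact E.integrable_of_bounded (g n).measurable hD ξ
  have hlim : Tendsto (fun n : ℕ => 1 / ((n : ℝ) + 1)) atTop (𝓝 0) :=
    tendsto_one_div_add_atTop_nhds_zero_nat
  have hdiff : ∀ N m n : ℕ, N ≤ m → N ≤ n → dist (T m) (T n) ≤ 2 * (2 * (1 / ((N : ℝ) + 1))) := by
    intro N m n hm hn
    rw [dist_eq_norm]
    apply norm_le_of_inner_le (by positivity)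
    intro ξ
    rw [sub_apply, inner_sub_right, hT m ξ, hT n ξ,
      ← integral_sub (hint m ξ) (hint n ξ)]
    apply E.norm_integral_le
    intro x
    have h1 := (hg m x).trans (Nat.one_div_le_one_div hm)
    have h2 := (hg n x).trans (Nat.one_div_le_one_div hn)
    have h3 := norm_sub_le (g m x - f x) (g n x - f x)
    rw [sub_sub_sub_cancel_right] at h3
    linarith
  have hc : CauchySeq T := by
    refine cauchySeq_of_le_tendsto_0 (fun N : ℕ => 2 * (2 * (1 / ((N : ℝ) + 1))))
      (fun n m N hn hm => hdiff N n m hn hm) ?_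
    simpa using (hlim.const_mul 2).const_mul 2
  obtain ⟨S, hS⟩ := cauchySeq_tendsto_of_complete hc
  refine ⟨S, fun ξ => ?_⟩
  have l1 : Tendsto (fun n => inner ℂ ξ (T n ξ)) atTop (𝓝 (inner ℂ ξ (S ξ))) := by
    have := ((ContinuousLinearMap.apply ℂ H ξ).continuous.tendsto S).comp hS
    exact tendsto_const_nhds.inner this
  have l2 : Tendsto (fun n => inner ℂ ξ (T n ξ)) atTop (𝓝 (∫ x, f x ∂(E.vecMeasure ξ))) := by
    rw [tendsto_iff_norm_sub_tendsto_zero]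
    refine squeeze_zero (fun _ => norm_nonneg _) (g := fun n : ℕ => 1 / ((n : ℝ) + 1) * ‖ξ‖ ^ 2)
      (fun n => ?_) (by simpa using hlim.mul_const (‖ξ‖ ^ 2))
    rw [hT n ξ, ← integral_sub (hint n ξ) (E.integrable_of_bounded hf hC ξ)]
    exact E.norm_integral_le (hg n) ξ
  exact tendsto_nhds_unique l1 l2

/-- The bounded operator `∫ f dE` for a bounded measurable function `f`. It is the unique operator
`T` with `⟨T ξ, ξ⟩ = ∫ f dμ_ξ` for all `ξ`. -/
noncomputable def integral (f : X → ℂ) (hf : Measurable f) (hb : ∃ C : ℝ, ∀ x, ‖f x‖ ≤ C) :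
    H →L[ℂ] H :=
  (E.exists_isIntegral hf hb).choose

theorem isIntegral_integral (f : X → ℂ) (hf : Measurable f) (hb : ∃ C : ℝ, ∀ x, ‖f x‖ ≤ C) :
    E.IsIntegral f (E.integral f hf hb) :=
  (E.exists_isIntegral hf hb).choose_spec

end General

/-- The unitary representation `v_E(k) = ∫ exp(i x·k) dE(x)` of `ℝ^d`. -/
noncomputable def rep {d : ℕ} {H : Type*} [NormedAddCommGroup H] [InnerProductSpace ℂ H]
    [CompleteSpace H] (E : SpectralMeasure (EuclideanSpace ℝ (Fin d)) H)
    (k : EuclideanSpace ℝ (Fin d)) : H →L[ℂ] H :=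
  E.integral (fun x => Complex.exp (Complex.I * ((inner ℝ x k : ℝ) : ℂ)))
    (by fun_prop)
    ⟨1, fun x => by rw [mul_comm, Complex.norm_exp_ofReal_mul_I]⟩

end SpectralMeasure

/-- A bounded operator `W` between Hilbert spaces with `d`-dimensional coordinate systems is smooth
if `k ↦ v₂(k) W v₁(-k)` is a smooth map from `ℝ^d` to the bounded operators with the operator
norm. -/
def IsSmoothMorphism {d : ℕ} {H₁ H₂ : Type*}
    [NormedAddCommGroup H₁] [InnerProductSpace ℂ H₁] [CompleteSpace H₁]
    [NormedAddCommGroup H₂] [InnerProductSpace ℂ H₂] [CompleteSpace H₂]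
    (E₁ : SpectralMeasure (EuclideanSpace ℝ (Fin d)) H₁)
    (E₂ : SpectralMeasure (EuclideanSpace ℝ (Fin d)) H₂) (W : H₁ →L[ℂ] H₂) : Prop :=
  ContDiff ℝ ∞ (fun k : EuclideanSpace ℝ (Fin d) => (E₂.rep k) ∘L W ∘L (E₁.rep (-k)))

/-- A `d`-dimensional discrete-time quantum walk `(H, (U^t)_{t ∈ ℤ}, E)` on the Hilbert space `H`.
A unitary representation of `ℤ` is given by its value `U` at `1`. -/
structure QuantumWalk (d : ℕ) (H : Type*) [NormedAddCommGroup H] [InnerProductSpace ℂ H]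
    [CompleteSpace H] where
  /-- The time evolution in one step. -/
  U : unitary (H →L[ℂ] H)
  /-- The coordinate system. -/
  E : SpectralMeasure (EuclideanSpace ℝ (Fin d)) H

namespace QuantumWalk

variable {d : ℕ} {H : Type*} [NormedAddCommGroup H] [InnerProductSpace ℂ H] [CompleteSpace H]

/-- The bounded operator `U^t`, for `t ∈ ℤ`. -/
noncomputable def evol (Q : QuantumWalk d H) (t : ℤ) : H →L[ℂ] H :=
  ((Q.U ^ t : unitary (H →L[ℂ] H)) : H →L[ℂ] H)

/-- The walk is smooth if `U^t` is a smooth morphism for every `t ∈ ℤ`. -/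
def IsSmooth (Q : QuantumWalk d H) : Prop :=
  ∀ t : ℤ, IsSmoothMorphism Q.E Q.E (Q.evol t)

/-- The velocity distribution `ν_{U,t,ξ}`: the push-forward of `μ_{U^t ξ}` along `x ↦ x / t`. -/
noncomputable def velocity (Q : QuantumWalk d H) (t : ℕ) (ξ : H) :
    Measure (EuclideanSpace ℝ (Fin d)) :=
  (Q.E.vecMeasure (Q.evol t ξ)).map (fun x => (t : ℝ)⁻¹ • x)

end QuantumWalk

/-! In each coordinate the evolution is shown to spread at most linearly in time, with a rate
independent of the initial vector. The unbounded position operator is replaced by the bounded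
difference operators `P = v_E(s e_i) - 1`, `0 < s ≤ 1`. Their symbol `exp(i s x_i) - 1` has modulus
at most `s |x_i|`, and at least `(2/π) s |x_i|` as long as `s |x_i| ≤ π`, so `P / s` measures
position on scales up to about `1 / s`.

Moving `P ^ n` past `U` produces iterated commutators of `v_E(s e_i)` with `U`. These are finite
differences of `x ↦ v_E(x e_i) U v_E(-x e_i)`, so smoothness bounds the `n`-th one by `c n * s ^ n`
with `c n` independent of `s` (`exists_leibniz_bound`).

The commutator bounds control the growth of `∑_{n ≤ N} a^n / n! ‖P^n ξ‖` in one step. For `a = N /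
(s t)`, `t` steps multiply it by at most `exp (N c 1 + O(1/t))`: only the first commutator survives,
since the higher ones carry a factor `(N / t) ^ 2` per step. Hence `‖P^N U^t ξ‖` is at most about
`(s t exp (c 1)) ^ N ‖ξ‖` when `ξ` is localized in `x_i` (`norm_pow_apply_pow_apply_le`). A
Chebyshev argument with `R = π exp (c 1)` then leaves at most about `2 ^ (-N)` of the norm in `|x_i|
≥ R t`, uniformly in `s`.

Since `R` does not depend on `N` or `ξ`, one lets `t → ∞`, then `N → ∞`, and reaches all vectors by
density of the localized ones. The set sought is the box with half-widths `R i`. -/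

namespace SpectralMeasure

/-! ### Multiplicative functional calculus of a spectral measure -/

section Calculus

variable {X : Type*} [MeasurableSpace X] {H : Type*} [NormedAddCommGroup H]
  [InnerProductSpace ℂ H] [CompleteSpace H] (E : SpectralMeasure X H)

theorem real_vecMeasure_eq_norm_sq (ξ : H) {s : Set X} (hs : MeasurableSet s) :
    (E.vecMeasure ξ).real s = ‖E.proj s ξ‖ ^ 2 := by
  rw [E.real_vecMeasure ξ s hs, E.re_inner_proj s hs]

theorem norm_proj_apply_le {s : Set X} (hs : MeasurableSet s) (ξ : H) :
    ‖E.proj s ξ‖ ≤ ‖ξ‖ := by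
  have h := measureReal_mono (μ := E.vecMeasure ξ) (Set.subset_univ s)
  rw [E.real_vecMeasure_eq_norm_sq ξ hs, E.real_vecMeasure_univ] at h
  exact (sq_le_sq₀ (norm_nonneg _) (norm_nonneg _)).mp h

theorem proj_proj {s : Set X} (hs : MeasurableSet s) (ξ : H) :
    E.proj s (E.proj s ξ) = E.proj s ξ := by
  rw [← mul_apply_eq_comp, (E.isStarProjection_proj s hs).isIdempotentElem.eq]

variable {E}

theorem IsIntegral.add {f g : X → ℂ} {S T : H →L[ℂ] H} (hS : E.IsIntegral f S)
    (hT : E.IsIntegral g T) (hf : ∀ ξ, Integrable f (E.vecMeasure ξ))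
    (hg : ∀ ξ, Integrable g (E.vecMeasure ξ)) :
    E.IsIntegral (fun x => f x + g x) (S + T) := fun ξ => by
  rw [add_apply, inner_add_right, hS ξ, hT ξ, integral_add (hf ξ) (hg ξ)]

theorem IsIntegral.const_mul {f : X → ℂ} {S : H →L[ℂ] H} (hS : E.IsIntegral f S) (c : ℂ) :
    E.IsIntegral (fun x => c * f x) (c • S) := fun ξ => by
  rw [smul_apply, inner_smul_right, hS ξ, integral_const_mul]

theorem IsIntegral.adjoint {f : X → ℂ} {S : H →L[ℂ] H} (hS : E.IsIntegral f S) :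
    E.IsIntegral (fun x => (starRingEnd ℂ) (f x)) (ContinuousLinearMap.adjoint S) := fun ξ => by
  rw [ContinuousLinearMap.adjoint_inner_right, ← inner_conj_symm, hS ξ, integral_conj]

variable (E)

theorem isIntegral_one : E.IsIntegral (fun _ => 1) 1 := fun ξ => by
  rw [one_apply_eq_self, inner_self_eq_norm_sq_to_K, integral_const,
    E.real_vecMeasure_univ]
  simp

theorem isIntegral_indicator {s : Set X} (hs : MeasurableSet s) :
    E.IsIntegral (s.indicator fun _ => 1) (E.proj s) := fun ξ => by
  rw [E.inner_proj s hs, ← E.real_vecMeasure ξ s hs, integral_indicator_const _ hs]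
  simp

theorem proj_union {s t : Set X} (hs : MeasurableSet s) (ht : MeasurableSet t)
    (hd : Disjoint s t) : E.proj (s ∪ t) = E.proj s + E.proj t := by
  have hi : ∀ {u : Set X}, MeasurableSet u → ∀ ξ,
      Integrable (u.indicator fun _ => (1 : ℂ)) (E.vecMeasure ξ) := fun hu ξ =>
    (integrable_const _).indicator hu
  have h := (E.isIntegral_indicator hs).add (E.isIntegral_indicator ht) (hi hs) (hi ht)
  refine (E.isIntegral_indicator (hs.union ht)).unique ?_
  rwa [Set.indicator_union_of_disjoint hd]

theorem proj_add_proj_compl {s : Set X} (hs : MeasurableSet s) :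
    E.proj s + E.proj sᶜ = 1 := by
  rw [← E.proj_union hs hs.compl disjoint_compl_right, Set.union_compl_self, E.proj_univ]

/-- Multiplicativity of `E` is a consequence of additivity: the vector `E(t) ξ` already has all of
its mass on `t`, so none remains for a disjoint `s`. -/
theorem proj_proj_of_disjoint {s t : Set X} (hs : MeasurableSet s) (ht : MeasurableSet t)
    (hd : Disjoint s t) (ξ : H) : E.proj s (E.proj t ξ) = 0 := by
  have h := measureReal_mono (μ := E.vecMeasure (E.proj t ξ)) (Set.subset_univ (s ∪ t))
  rw [measureReal_union hd ht, E.real_vecMeasure_eq_norm_sq _ hs,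
    E.real_vecMeasure_eq_norm_sq _ ht, E.real_vecMeasure_univ, E.proj_proj ht] at h
  have h2 : ‖E.proj s (E.proj t ξ)‖ ^ 2 = 0 := le_antisymm (by linarith) (by positivity)
  simpa using h2

theorem proj_inter {s t : Set X} (hs : MeasurableSet s) (ht : MeasurableSet t) (ξ : H) :
    E.proj s (E.proj t ξ) = E.proj (s ∩ t) ξ := by
  have h1 : E.proj s = E.proj (s ∩ t) + E.proj (s \ t) := by
    rw [← E.proj_union (hs.inter ht) (hs.diff ht) Set.disjoint_sdiff_inter.symm,
      Set.inter_union_sdiff]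
  have h2 : E.proj t = E.proj (s ∩ t) + E.proj (t \ s) := by
    rw [Set.inter_comm, ← E.proj_union (ht.inter hs) (ht.diff hs) Set.disjoint_sdiff_inter.symm,
      Set.inter_union_sdiff]
  have h3 : E.proj (s ∩ t) (E.proj (t \ s) ξ) = 0 :=
    E.proj_proj_of_disjoint (hs.inter ht) (ht.diff hs)
      (Set.disjoint_sdiff_right.mono_left Set.inter_subset_left) ξ
  have h4 : E.proj (s \ t) (E.proj t ξ) = 0 :=
    E.proj_proj_of_disjoint (hs.diff ht) ht Set.disjoint_sdiff_left ξ
  rw [h1, add_apply, h4, add_zero, h2, add_apply, map_add, h3, add_zero,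
    E.proj_proj (hs.inter ht)]

theorem vecMeasure_proj {s : Set X} (hs : MeasurableSet s) (ξ : H) :
    E.vecMeasure (E.proj s ξ) = (E.vecMeasure ξ).restrict s := by
  ext t ht
  rw [Measure.restrict_apply ht, E.vecMeasure_apply _ _ ht, E.vecMeasure_apply _ _ (ht.inter hs),
    E.re_inner_proj _ ht, E.re_inner_proj _ (ht.inter hs), E.proj_inter ht hs]

variable {E}

theorem IsIntegral.compress {f : X → ℂ} {T : H →L[ℂ] H} (hT : E.IsIntegral f T)
    {s : Set X} (hs : MeasurableSet s) :
    E.IsIntegral (s.indicator f) (E.proj s * (T * E.proj s)) := fun ξ => by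
  have h := (E.isStarProjection_proj s hs).isSelfAdjoint.isSymmetric ξ (T (E.proj s ξ))
  simp only [ContinuousLinearMap.coe_coe] at h
  rw [mul_apply_eq_comp, mul_apply_eq_comp, ← h, hT, E.vecMeasure_proj hs, integral_indicator hs]

/-- By uniqueness of the integral, `f = 1_s f + 1_{sᶜ} f` makes `T` block diagonal for `E(s)` and
`E(sᶜ)`. Hence `E(s) T` equals the compression `E(s) T E(s)`. -/
theorem IsIntegral.proj_mul {f : X → ℂ} {T : H →L[ℂ] H} (hT : E.IsIntegral f T)
    (hf : ∀ ξ, Integrable f (E.vecMeasure ξ)) {s : Set X} (hs : MeasurableSet s) :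
    E.IsIntegral (s.indicator f) (E.proj s * T) := by
  have h1 := hT.compress hs
  have h2 := hT.compress hs.compl
  have h3 := h1.add h2 (fun ξ => (hf ξ).indicator hs) (fun ξ => (hf ξ).indicator hs.compl)
  have h4 : T = E.proj s * (T * E.proj s) + E.proj sᶜ * (T * E.proj sᶜ) := by
    refine hT.unique ?_
    have : f = fun x => s.indicator f x + sᶜ.indicator f x := by
      ext x; rw [Set.indicator_self_add_compl_apply]
    rwa [← this] at h3
  have h5 : E.proj s * T = E.proj s * (T * E.proj s) := by
    conv_lhs => rw [h4]
    have h6 : E.proj s * E.proj sᶜ = 0 := by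
      ext ξ; exact E.proj_proj_of_disjoint hs hs.compl disjoint_compl_right ξ
    rw [mul_add, ← mul_assoc, (E.isStarProjection_proj s hs).isIdempotentElem.eq,
      ← mul_assoc (E.proj s) (E.proj sᶜ), h6, zero_mul, add_zero]
  rwa [h5]

variable (E)

theorem norm_sub_le_of_isIntegral {f g : X → ℂ} {S T : H →L[ℂ] H} (hS : E.IsIntegral f S)
    (hT : E.IsIntegral g T) (hf : ∀ ξ, Integrable f (E.vecMeasure ξ))
    (hg : ∀ ξ, Integrable g (E.vecMeasure ξ)) {ε : ℝ} (hε : 0 ≤ ε)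
    (h : ∀ x, ‖f x - g x‖ ≤ ε) : ‖S - T‖ ≤ 2 * ε := by
  apply norm_le_of_inner_le hε
  intro ξ
  rw [sub_apply, inner_sub_right, hS ξ, hT ξ, ← integral_sub (hf ξ) (hg ξ)]
  exact E.norm_integral_le h ξ

variable {E}

theorem IsIntegral.simpleFunc_mul {f : X → ℂ} {T : H →L[ℂ] H} (hT : E.IsIntegral f T)
    (hf : Measurable f) {C : ℝ} (hC : ∀ x, ‖f x‖ ≤ C) (g : SimpleFunc X ℂ) :
    ∀ S, E.IsIntegral g S → E.IsIntegral (fun x => g x * f x) (S * T) := by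
  have hfi := E.integrable_of_bounded hf hC
  have hgi : ∀ g : SimpleFunc X ℂ, ∀ ξ, Integrable g (E.vecMeasure ξ) := fun g ξ => by
    obtain ⟨D, hD⟩ := g.exists_forall_norm_le
    exact E.integrable_of_bounded g.measurable hD ξ
  have hgf : ∀ g : SimpleFunc X ℂ, ∀ ξ, Integrable (fun x => g x * f x) (E.vecMeasure ξ) :=
    fun g ξ => by
    obtain ⟨D, hD⟩ := g.exists_forall_norm_le
    exact (hfi ξ).bdd_mul g.measurable.aestronglyMeasurable (Eventually.of_forall hD)
  induction g using SimpleFunc.induction with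
  | const c hs =>
    rename_i s
    intro S hS
    have h1 := (E.isIntegral_indicator hs).const_mul c
    have h2 : S = c • E.proj s := by
      refine hS.unique ?_
      convert h1 using 2 with x
      by_cases hx : x ∈ s <;> simp [hx]
    have h3 := (hT.proj_mul hfi hs).const_mul c
    rw [h2, smul_mul_assoc]
    convert h3 using 2 with x
    by_cases hx : x ∈ s <;> simp [hx]
  | add hd h1 h2 =>
    rename_i g₁ g₂
    intro S hS
    obtain ⟨S₁, hS₁⟩ := E.exists_isIntegral_simpleFunc g₁
    obtain ⟨S₂, hS₂⟩ := E.exists_isIntegral_simpleFunc g₂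
    have h3 : S = S₁ + S₂ := hS.unique (hS₁.add hS₂ (hgi g₁) (hgi g₂))
    have h4 := (h1 S₁ hS₁).add (h2 S₂ hS₂) (hgf g₁) (hgf g₂)
    rw [h3, add_mul]
    convert h4 using 2 with x
    simp [add_mul]

/-- The case of a simple `g` is linear in indicators; uniform approximation of `g` gives the rest.
Multiplicativity turns `‖T ^ n ξ‖ ^ 2` into a moment of `μ_ξ`. -/
theorem IsIntegral.mul {f g : X → ℂ} {S T : H →L[ℂ] H} (hS : E.IsIntegral g S)
    (hT : E.IsIntegral f T) (hg : Measurable g) {D : ℝ} (hD : ∀ x, ‖g x‖ ≤ D)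
    (hf : Measurable f) {C : ℝ} (hC : ∀ x, ‖f x‖ ≤ C) :
    E.IsIntegral (fun x => g x * f x) (S * T) := by
  have hfg : ∀ ξ, Integrable (fun x => g x * f x) (E.vecMeasure ξ) := fun ξ =>
    (E.integrable_of_bounded hf hC ξ).bdd_mul hg.aestronglyMeasurable (Eventually.of_forall hD)
  obtain ⟨V, hV⟩ := E.exists_isIntegral (hg.mul hf) ⟨D * C, fun x => by
    rw [Pi.mul_apply, norm_mul]
    exact mul_le_mul (hD x) (hC x) (norm_nonneg _) ((norm_nonneg _).trans (hD x))⟩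
  suffices h : S * T = V by rw [h]; exact hV
  rw [← sub_eq_zero, ← norm_le_zero_iff]
  have key : ∀ ε : ℝ, 0 < ε → ‖S * T - V‖ ≤ ε * (2 * ‖T‖ + 2 * |C|) := by
    intro ε hε
    obtain ⟨G, hG⟩ := exists_simpleFunc_near hg hD hε
    obtain ⟨R, hR⟩ := E.exists_isIntegral_simpleFunc G
    have h1 := hT.simpleFunc_mul hf hC G R hR
    obtain ⟨B, hB⟩ := G.exists_forall_norm_le
    have hGi := E.integrable_of_bounded G.measurable hB
    have h2 : ‖S - R‖ ≤ 2 * ε := E.norm_sub_le_of_isIntegral hS hR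
      (E.integrable_of_bounded hg hD) hGi hε.le
      (fun x => by rw [norm_sub_rev]; exact hG x)
    have h3 : ‖R * T - V‖ ≤ 2 * (ε * |C|) := by
      refine E.norm_sub_le_of_isIntegral h1 hV (fun ξ => (E.integrable_of_bounded hf hC ξ).bdd_mul
        G.measurable.aestronglyMeasurable (Eventually.of_forall hB)) hfg (by positivity) fun x => ?_
      rw [Pi.mul_apply, ← sub_mul, norm_mul]
      exact mul_le_mul (hG x) ((hC x).trans (le_abs_self C)) (norm_nonneg _) hε.le
    calc ‖S * T - V‖ = ‖(S - R) * T + (R * T - V)‖ := by congr 1; noncomm_ring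
      _ ≤ ‖S - R‖ * ‖T‖ + ‖R * T - V‖ := (norm_add_le _ _).trans (by gcongr; exact norm_mul_le _ _)
      _ ≤ 2 * ε * ‖T‖ + 2 * (ε * |C|) := by gcongr
      _ = ε * (2 * ‖T‖ + 2 * |C|) := by ring
  have hl : Tendsto (fun ε : ℝ => ε * (2 * ‖T‖ + 2 * |C|)) (𝓝[>] 0) (𝓝 0) := by
    have : Tendsto (fun ε : ℝ => ε * (2 * ‖T‖ + 2 * |C|)) (𝓝 0) (𝓝 (0 * (2 * ‖T‖ + 2 * |C|))) :=
      tendsto_id.mul_const _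
    rw [zero_mul] at this
    exact this.mono_left nhdsWithin_le_nhds
  exact ge_of_tendsto hl (by filter_upwards [self_mem_nhdsWithin] with ε hε using key ε hε)

theorem IsIntegral.pow {f : X → ℂ} {T : H →L[ℂ] H} (hT : E.IsIntegral f T)
    (hf : Measurable f) {C : ℝ} (hC : ∀ x, ‖f x‖ ≤ C) (n : ℕ) :
    E.IsIntegral (fun x => f x ^ n) (T ^ n) := by
  induction n with
  | zero => simpa using E.isIntegral_one
  | succ n ih =>
    simp only [pow_succ]
    exact ih.mul hT (hf.pow_const n) (D := C ^ n)
      (fun x => by rw [norm_pow]; exact pow_le_pow_left₀ (norm_nonneg _) (hC x) n) hf hC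

theorem IsIntegral.norm_apply_sq {f : X → ℂ} {T : H →L[ℂ] H} (hT : E.IsIntegral f T)
    (hf : Measurable f) {C : ℝ} (hC : ∀ x, ‖f x‖ ≤ C) (ξ : H) :
    ‖T ξ‖ ^ 2 = ∫ x, ‖f x‖ ^ 2 ∂(E.vecMeasure ξ) := by
  have h := hT.adjoint.mul hT (Complex.continuous_conj.measurable.comp hf) (D := C)
    (fun x => by rw [RCLike.norm_conj]; exact hC x) hf hC ξ
  rw [mul_apply_eq_comp, ContinuousLinearMap.adjoint_inner_right, inner_self_eq_norm_sq_to_K] at h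
  have h2 : ∀ x, (starRingEnd ℂ) (f x) * f x = ((‖f x‖ ^ 2 : ℝ) : ℂ) := fun x => by
    rw [mul_comm, Complex.mul_conj, Complex.normSq_eq_norm_sq]
  simp only [h2] at h
  have h3 := integral_ofReal (𝕜 := ℂ) (μ := E.vecMeasure ξ) (f := fun x => ‖f x‖ ^ 2)
  exact_mod_cast h.trans h3

theorem IsIntegral.norm_pow_apply_sq {f : X → ℂ} {T : H →L[ℂ] H} (hT : E.IsIntegral f T)
    (hf : Measurable f) {C : ℝ} (hC : ∀ x, ‖f x‖ ≤ C) (n : ℕ) (ξ : H) :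
    ‖(T ^ n) ξ‖ ^ 2 = ∫ x, ‖f x‖ ^ (2 * n) ∂(E.vecMeasure ξ) := by
  rw [(hT.pow hf hC n).norm_apply_sq (hf.pow_const n) (C := C ^ n)
    (fun x => by rw [norm_pow]; exact pow_le_pow_left₀ (norm_nonneg _) (hC x) n)]
  simp only [norm_pow, ← pow_mul, mul_comm]

/-- If `|f| ≤ c` on a set that carries `μ_ξ`, then `‖(∫ f dE)^n ξ‖ ≤ c^n ‖ξ‖`. -/
theorem IsIntegral.norm_pow_apply_le {f : X → ℂ} {T : H →L[ℂ] H} (hT : E.IsIntegral f T)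
    (hf : Measurable f) {C : ℝ} (hC : ∀ x, ‖f x‖ ≤ C) {s : Set X} (hs : MeasurableSet s)
    {c : ℝ} (hc : 0 ≤ c) (hfs : ∀ x ∈ s, ‖f x‖ ≤ c) (n : ℕ) {ξ : H} (hξ : E.proj s ξ = ξ) :
    ‖(T ^ n) ξ‖ ≤ c ^ n * ‖ξ‖ := by
  have hC0 : ∀ x, ‖f x‖ ^ (2 * n) ≤ C ^ (2 * n) := fun x =>
    pow_le_pow_left₀ (norm_nonneg _) (hC x) _
  refine (sq_le_sq₀ (norm_nonneg _) (by positivity)).mp ?_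
  rw [hT.norm_pow_apply_sq hf hC, mul_pow, ← E.real_vecMeasure_univ ξ, ← pow_mul,
    Nat.mul_comm n 2]
  have : ∫ x, ‖f x‖ ^ (2 * n) ∂(E.vecMeasure ξ) ≤ ∫ _, c ^ (2 * n) ∂(E.vecMeasure ξ) := by
    refine integral_mono_ae (Integrable.of_bound (hf.norm.pow_const _).aestronglyMeasurable
      (C ^ (2 * n)) (Eventually.of_forall fun x => by
        rw [Real.norm_of_nonneg (by positivity)]; exact hC0 x)) (integrable_const _) ?_
    rw [← hξ, E.vecMeasure_proj hs]
    filter_upwards [ae_restrict_mem hs] with x hx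
    exact pow_le_pow_left₀ (norm_nonneg _) (hfs x hx) _
  rw [integral_const, smul_eq_mul, mul_comm ((E.vecMeasure ξ).real _)] at this
  exact this

/-- If `c ≤ |f|` on `s`, then `c^n ‖E(s) ξ‖ ≤ ‖(∫ f dE)^n ξ‖`. -/
theorem IsIntegral.le_norm_pow_apply {f : X → ℂ} {T : H →L[ℂ] H} (hT : E.IsIntegral f T)
    (hf : Measurable f) {C : ℝ} (hC : ∀ x, ‖f x‖ ≤ C) {s : Set X} (hs : MeasurableSet s)
    {c : ℝ} (hc : 0 ≤ c) (hfs : ∀ x ∈ s, c ≤ ‖f x‖) (n : ℕ) (ξ : H) :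
    c ^ n * ‖E.proj s ξ‖ ≤ ‖(T ^ n) ξ‖ := by
  have hC0 : ∀ x, ‖f x‖ ^ (2 * n) ≤ C ^ (2 * n) := fun x =>
    pow_le_pow_left₀ (norm_nonneg _) (hC x) _
  refine (sq_le_sq₀ (by positivity) (norm_nonneg _)).mp ?_
  rw [hT.norm_pow_apply_sq hf hC, mul_pow, ← E.real_vecMeasure_eq_norm_sq ξ hs, ← pow_mul,
    Nat.mul_comm n 2]
  have : ∫ x, s.indicator (fun _ => c ^ (2 * n)) x ∂(E.vecMeasure ξ)
      ≤ ∫ x, ‖f x‖ ^ (2 * n) ∂(E.vecMeasure ξ) := by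
    refine integral_mono ((integrable_const _).indicator hs)
      (Integrable.of_bound (hf.norm.pow_const _).aestronglyMeasurable
      (C ^ (2 * n)) (Eventually.of_forall fun x => by
        rw [Real.norm_of_nonneg (by positivity)]; exact hC0 x)) fun x => ?_
    refine Set.indicator_le' (fun x hx => pow_le_pow_left₀ hc (hfs x hx) _)
      (fun x _ => by positivity) x
  rwa [integral_indicator_const _ hs, smul_eq_mul, mul_comm] at this

end Calculus

end SpectralMeasure

/-! ### Iterated commutators as finite differences -/

section Commutator

variable {A : Type*} [Ring A]

/-- The hypothesis expresses `W (x + s) = v W(x) v⁻¹` without inverting `v`; conjugation commutes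
with differencing. -/
theorem mul_fwdDiff_iter_of_equivariant {v : A} {s : ℝ} {W : ℝ → A}
    (hW : ∀ x, v * W x = W (x + s) * v) (n : ℕ) (x : ℝ) :
    v * (fwdDiff s)^[n] W x = (fwdDiff s)^[n] W (x + s) * v := by
  induction n generalizing x with
  | zero => exact hW x
  | succ n ih =>
    rw [Function.iterate_succ_apply', fwdDiff, fwdDiff, mul_sub, sub_mul, ih, ih]

variable [Algebra ℝ A]

/-- Leibniz rule: moving powers of `v - 1` past `u` produces iterated commutators with `v`. -/
theorem sub_one_pow_mul_eq_sum (v u : A) (n : ℕ) :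
    (v - 1) ^ n * u = ∑ p ∈ Finset.HasAntidiagonal.antidiagonal n, (n.choose p.1 : ℝ) •
      (((LinearMap.mulLeft ℝ v - LinearMap.mulRight ℝ v) ^ p.1) u * (v - 1) ^ p.2) := by
  have hc : Commute (LinearMap.mulLeft ℝ v - LinearMap.mulRight ℝ v)
      (LinearMap.mulRight ℝ (v - 1)) := by
    refine (LinearMap.commute_mulLeft_right v (v - 1)).sub_left ?_
    ext x
    simp only [Module.End.mul_apply, LinearMap.mulRight_apply]
    noncomm_ring
  -- Left multiplication by `v - 1` is the sum of the commutator with `v` and right multiplication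
  -- by `v - 1`. The two commute, so the Leibniz rule is the binomial theorem.
  have hs : LinearMap.mulLeft ℝ (v - 1) =
      (LinearMap.mulLeft ℝ v - LinearMap.mulRight ℝ v) + LinearMap.mulRight ℝ (v - 1) := by
    ext x
    simp only [LinearMap.add_apply, LinearMap.sub_apply, LinearMap.mulRight_apply,
      LinearMap.mulLeft_apply]
    noncomm_ring
  have h := congrArg (fun T : A →ₗ[ℝ] A => T u) (congrArg (· ^ n) hs)
  simp only [LinearMap.pow_mulLeft, LinearMap.mulLeft_apply] at h
  rw [h, hc.add_pow', LinearMap.sum_apply]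
  refine Finset.sum_congr rfl fun p _ => ?_
  rw [LinearMap.smul_apply, ((hc.pow_pow p.1 p.2).eq), Module.End.mul_apply,
    LinearMap.pow_mulRight, LinearMap.mulRight_apply, Nat.cast_smul_eq_nsmul]

/-- Iterated commutators with `v` are finite differences of `x ↦ v^x u v^{-x}`. -/
theorem commutator_iter_eq_fwdDiff_iter {v : A} {s : ℝ} {W : ℝ → A}
    (hW : ∀ x, v * W x = W (x + s) * v) (n : ℕ) (x : ℝ) :
    ((LinearMap.mulLeft ℝ v - LinearMap.mulRight ℝ v) ^ n) (W x) =
      (fwdDiff s)^[n] W x * v ^ n := by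
  induction n with
  | zero => simp
  | succ n ih =>
    rw [pow_succ', Module.End.mul_apply, ih, LinearMap.sub_apply, LinearMap.mulLeft_apply,
      LinearMap.mulRight_apply, ← mul_assoc, mul_fwdDiff_iter_of_equivariant hW,
      Function.iterate_succ_apply', fwdDiff, sub_mul, mul_assoc, mul_assoc, ← pow_succ,
      ← pow_succ']

end Commutator

/-! ### Finite differences of smooth functions -/

section FiniteDifference

variable {F : Type*} [NormedAddCommGroup F] [NormedSpace ℝ F]

/-- Each difference costs one derivative and gains a factor `s` by the mean value inequality. The
induction passes from `f` to `fwdDiff s f`, which needs control on an interval shorter by `s`. -/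
theorem norm_fwdDiff_iter_le {s : ℝ} (hs : 0 ≤ s) {C : ℝ} (n : ℕ) {f : ℝ → F}
    (hf : ContDiff ℝ n f) {x : ℝ}
    (hC : ∀ y ∈ Set.Icc x (x + n * s), ‖iteratedDeriv n f y‖ ≤ C) :
    ‖(fwdDiff s)^[n] f x‖ ≤ C * s ^ n := by
  induction n generalizing f C with
  | zero => simpa using hC x (by simp)
  | succ n ih =>
    rw [Function.iterate_succ_apply]
    have hfn : ContDiff ℝ n f := hf.of_le (by exact_mod_cast n.le_succ)
    have hfs : ContDiff ℝ n (fun y => f (y + s)) := hfn.comp (contDiff_id.add contDiff_const)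
    have key : ∀ y ∈ Set.Icc x (x + n * s), ‖iteratedDeriv n (fwdDiff s f) y‖ ≤ C * s := by
      intro y hy
      have h1 : iteratedDeriv n (fwdDiff s f) y =
          iteratedDeriv n f (y + s) - iteratedDeriv n f y := by
        have := iteratedDeriv_fun_sub (x := y) hfs.contDiffAt hfn.contDiffAt
        rw [iteratedDeriv_comp_add_const] at this
        exact this
      rw [h1]
      have hd : Differentiable ℝ (iteratedDeriv n f) :=
        hf.differentiable_iteratedDeriv n (by exact_mod_cast n.lt_succ_self)
      have h2 := (convex_Icc y (y + s)).norm_image_sub_le_of_norm_deriv_le (𝕜 := ℝ)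
        (f := iteratedDeriv n f) (C := C) (x := y) (y := y + s) (fun z _ => hd z)
        (fun z hz => by
          rw [← iteratedDeriv_succ]
          refine hC z ⟨hy.1.trans hz.1, ?_⟩
          have := hz.2
          have := hy.2
          push_cast
          linarith)
        ⟨le_rfl, by linarith⟩ ⟨by linarith, le_rfl⟩
      rwa [add_sub_cancel_left, Real.norm_of_nonneg hs] at h2
    have hg : ContDiff ℝ n (fwdDiff s f) := hfs.sub hfn
    calc _ ≤ C * s * s ^ n := ih hg key
      _ = C * s ^ (n + 1) := by ring

/-- For `s ≤ 1` everything takes place in the fixed compact interval `[0, n]`, which makes `C`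
independent of `s`. -/
theorem ContDiff.exists_norm_fwdDiff_iter_le {f : ℝ → F} (hf : ContDiff ℝ ∞ f) (n : ℕ) :
    ∃ C : ℝ, 0 ≤ C ∧ ∀ s ∈ Set.Icc (0 : ℝ) 1, ‖(fwdDiff s)^[n] f 0‖ ≤ C * s ^ n := by
  have hn : ContDiff ℝ n f := hf.of_le (by exact_mod_cast le_top)
  obtain ⟨C, hC⟩ := isCompact_Icc.exists_bound_of_continuousOn (s := Set.Icc (0 : ℝ) n)
    (hn.continuous_iteratedDeriv n le_rfl).continuousOn
  refine ⟨C, (norm_nonneg _).trans (hC 0 ⟨le_rfl, by positivity⟩), fun s hs => ?_⟩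
  refine norm_fwdDiff_iter_le hs.1 n hn fun y hy => hC y ⟨hy.1, hy.2.trans ?_⟩
  rw [zero_add]
  exact mul_le_of_le_one_right (by positivity) hs.2

end FiniteDifference

/-! ### Weighted norms and their growth in time -/

theorem Finset.sum_antidiagonal_range_le {f : ℕ → ℕ → ℝ} (hf : ∀ i j, 0 ≤ f i j) (N : ℕ) :
    ∑ n ∈ Finset.range N, ∑ p ∈ Finset.HasAntidiagonal.antidiagonal n, f p.1 p.2 ≤
      ∑ i ∈ Finset.range N, ∑ j ∈ Finset.range N, f i j := by
  rw [← Finset.sum_product' (Finset.range N) (Finset.range N) f]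
  calc _ = ∑ n ∈ Finset.range N, ∑ p ∈ ((Finset.range N ×ˢ Finset.range N).filter
        (fun p => p.1 + p.2 ∈ Finset.range N)) with p.1 + p.2 = n, f p.1 p.2 := by
        refine Finset.sum_congr rfl fun n hn => Finset.sum_congr ?_ fun _ _ => rfl
        ext p
        simp only [Finset.HasAntidiagonal.mem_antidiagonal, Finset.mem_filter, Finset.mem_product,
          Finset.mem_range] at hn ⊢
        omega
    _ = ∑ p ∈ (Finset.range N ×ˢ Finset.range N).filter
        (fun p => p.1 + p.2 ∈ Finset.range N), f p.1 p.2 :=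
        Finset.sum_fiberwise_of_maps_to (fun p hp => (Finset.mem_filter.mp hp).2) _
    _ ≤ _ := Finset.sum_le_sum_of_subset_of_nonneg (Finset.filter_subset _ _)
        fun p _ _ => hf p.1 p.2

section WeightedNorm

variable {H : Type*} [NormedAddCommGroup H] [NormedSpace ℂ H]

/-- The weighted Sobolev-type norm `∑_{n ≤ N} a^n / n! ‖P^n ξ‖`. -/
noncomputable def weightedNorm (N : ℕ) (a : ℝ) (P : H →L[ℂ] H) (ξ : H) : ℝ :=
  ∑ n ∈ Finset.range (N + 1), a ^ n / n.factorial * ‖(P ^ n) ξ‖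

theorem weightedNorm_nonneg (N : ℕ) {a : ℝ} (ha : 0 ≤ a) (P : H →L[ℂ] H) (ξ : H) :
    0 ≤ weightedNorm N a P ξ :=
  Finset.sum_nonneg fun _ _ => by positivity

theorem le_weightedNorm (N : ℕ) {a : ℝ} (ha : 0 ≤ a) (P : H →L[ℂ] H) (ξ : H) :
    a ^ N / N.factorial * ‖(P ^ N) ξ‖ ≤ weightedNorm N a P ξ :=
  Finset.single_le_sum (f := fun n => a ^ n / (n.factorial : ℝ) * ‖(P ^ n) ξ‖)
    (fun _ _ => by positivity) (Finset.self_mem_range_succ N)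

/-- The weights `a^n / n!` absorb the binomial coefficients, so the Leibniz sum becomes a truncated
Cauchy product, bounded by the full product of the two sums. -/
theorem weightedNorm_apply_le {N : ℕ} {a : ℝ} (ha : 0 ≤ a) {P U : H →L[ℂ] H} {b : ℕ → ℝ}
    (hb : ∀ n, 0 ≤ b n)
    (h : ∀ n ξ, ‖(P ^ n) (U ξ)‖ ≤
      ∑ p ∈ Finset.HasAntidiagonal.antidiagonal n, (n.choose p.1 : ℝ) * (b p.1 * ‖(P ^ p.2) ξ‖)) (ξ : H) :
    weightedNorm N a P (U ξ) ≤
      (∑ n ∈ Finset.range (N + 1), a ^ n / n.factorial * b n) * weightedNorm N a P ξ := by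
  rw [weightedNorm, weightedNorm, Finset.sum_mul_sum]
  refine le_trans (Finset.sum_le_sum fun n _ => ?_) (Finset.sum_antidiagonal_range_le
    (f := fun i j => a ^ i / i.factorial * b i * (a ^ j / j.factorial * ‖(P ^ j) ξ‖))
    (fun i j => by have := hb i; positivity) (N + 1))
  refine (mul_le_mul_of_nonneg_left (h n ξ) (by positivity)).trans_eq ?_
  rw [Finset.mul_sum]
  refine Finset.sum_congr rfl fun p hp => ?_
  rw [Finset.HasAntidiagonal.mem_antidiagonal] at hp
  subst hp
  have := Nat.add_choose_mul_factorial_mul_factorial p.1 p.2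
  rw [← Nat.choose_symm_add] at this
  have h1 : ((p.1 + p.2).factorial : ℝ) =
      ((p.1 + p.2).choose p.1 : ℝ) * p.1.factorial * p.2.factorial := by exact_mod_cast this.symm
  have h2 : ((p.1 + p.2).choose p.1 : ℝ) ≠ 0 := by
    exact_mod_cast (Nat.choose_pos (Nat.le_add_right _ _)).ne'
  rw [h1, pow_add]
  field_simp

theorem weightedNorm_pow_apply_le {N : ℕ} {a B : ℝ} (hB : 0 ≤ B)
    {P U : H →L[ℂ] H} (h : ∀ ξ, weightedNorm N a P (U ξ) ≤ B * weightedNorm N a P ξ)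
    (t : ℕ) (ξ : H) : weightedNorm N a P ((U ^ t) ξ) ≤ B ^ t * weightedNorm N a P ξ := by
  induction t with
  | zero => simp
  | succ t ih =>
    rw [pow_succ' U, mul_apply_eq_comp, pow_succ', mul_assoc]
    exact (h _).trans (mul_le_mul_of_nonneg_left ih hB)

/-- The linear term is kept exactly and the rest is `O(l ^ 2)`. With `l` of order `1 / t`, the
`t`-th power of this bound retains only `c 1` in the limit. -/
theorem sum_range_factorial_le {c : ℕ → ℝ} (hc : ∀ n, 0 ≤ c n) (hc0 : c 0 = 1) (M : ℕ) {l : ℝ}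
    (hl : 0 ≤ l) (hl1 : l ≤ 1) :
    ∑ n ∈ Finset.range (M + 2), l ^ n / n.factorial * c n ≤
      Real.exp (l * c 1 + l ^ 2 * ∑ n ∈ Finset.range M, c (n + 2)) := by
  rw [Finset.sum_range_succ', Finset.sum_range_succ']
  simp only [zero_add, pow_zero, pow_one, Nat.factorial_zero, Nat.factorial_one, Nat.cast_one,
    div_one, one_mul, hc0, add_assoc, Nat.reduceAdd]
  have h : ∑ n ∈ Finset.range M, l ^ (n + 2) / (n + 2).factorial * c (n + 2) ≤
      l ^ 2 * ∑ n ∈ Finset.range M, c (n + 2) := by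
    rw [Finset.mul_sum]
    refine Finset.sum_le_sum fun n _ => mul_le_mul_of_nonneg_right ?_ (hc _)
    calc l ^ (n + 2) / ((n + 2).factorial : ℝ) ≤ l ^ (n + 2) :=
          div_le_self (by positivity) (by exact_mod_cast Nat.factorial_pos (n + 2))
      _ ≤ l ^ 2 := pow_le_pow_of_le_one hl hl1 (by omega)
  have := Real.add_one_le_exp (l * c 1 + l ^ 2 * ∑ n ∈ Finset.range M, c (n + 2))
  linarith

/-- Propagation bound: under `t` steps the `N`-th power of the difference operator `P` (of step `s`)
grows like `(s t)^N e^{N c₁}`, up to a factor that tends to `1`. -/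
theorem norm_pow_apply_pow_apply_le {P U : H →L[ℂ] H} {s : ℝ} (hs : 0 < s) {c : ℕ → ℝ}
    (hc : ∀ n, 0 ≤ c n) (hc0 : c 0 = 1)
    (h : ∀ n ξ, ‖(P ^ n) (U ξ)‖ ≤
      ∑ p ∈ Finset.HasAntidiagonal.antidiagonal n, (n.choose p.1 : ℝ) * (c p.1 * s ^ p.1 * ‖(P ^ p.2) ξ‖))
    {r : ℝ} (hr : 0 ≤ r) {ξ : H} (hξ : ∀ n, ‖(P ^ n) ξ‖ ≤ (s * r) ^ n * ‖ξ‖) (M t : ℕ)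
    (ht : M + 1 ≤ t) :
    ‖(P ^ (M + 1)) ((U ^ t) ξ)‖ ≤ (s * t) ^ (M + 1) * (Real.exp ((M + 1) * c 1) *
      Real.exp (((M + 1) ^ 2 * (∑ n ∈ Finset.range M, c (n + 2)) + (M + 1) * r) / t)) * ‖ξ‖ := by
  have ht0 : (0 : ℝ) < t := by exact_mod_cast (Nat.succ_pos M).trans_le ht
  set N : ℝ := (M : ℝ) + 1 with hN
  have hNpos : 0 < N := by positivity
  set K : ℝ := ∑ n ∈ Finset.range M, c (n + 2)
  -- The weight `a = l / s` is chosen so that `t` steps cost a bounded factor, while `a ^ N`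
  -- compensates `(s t) ^ N` up to `N ^ N`.
  set l : ℝ := N / t with hl
  have hlpos : 0 < l := by positivity
  have hl1 : l ≤ 1 := by
    rw [hl, div_le_one ht0, hN]
    exact_mod_cast ht
  have ha : 0 ≤ l / s := by positivity
  have step : ∀ η, weightedNorm (M + 1) (l / s) P (U η) ≤
      Real.exp (l * c 1 + l ^ 2 * K) * weightedNorm (M + 1) (l / s) P η := fun η => by
    refine (weightedNorm_apply_le ha (b := fun n => c n * s ^ n)
      (fun n => by have := hc n; positivity) h η).trans
      (mul_le_mul_of_nonneg_right (le_trans (le_of_eq ?_)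
        (sum_range_factorial_le hc hc0 M hlpos.le hl1)) (weightedNorm_nonneg _ ha _ _))
    refine Finset.sum_congr rfl fun n _ => ?_
    rw [div_pow]
    field_simp
  have start : weightedNorm (M + 1) (l / s) P ξ ≤ Real.exp (l * r) * ‖ξ‖ := by
    refine le_trans ?_ (mul_le_mul_of_nonneg_right
      (Real.sum_le_exp_of_nonneg (mul_nonneg hlpos.le hr) (M + 2)) (norm_nonneg ξ))
    rw [Finset.sum_mul]
    refine Finset.sum_le_sum fun n _ => ?_
    refine (mul_le_mul_of_nonneg_left (hξ n) (by positivity)).trans_eq ?_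
    rw [div_pow, mul_pow, mul_pow]
    field_simp
  have total := (le_weightedNorm (M + 1) ha P ((U ^ t) ξ)).trans
    ((weightedNorm_pow_apply_le (Real.exp_nonneg _) step t ξ).trans
      (mul_le_mul_of_nonneg_left start (by positivity)))
  rw [← Real.exp_nat_mul, ← mul_assoc, ← Real.exp_add] at total
  have he : (t : ℝ) * (l * c 1 + l ^ 2 * K) + l * r = N * c 1 + (N ^ 2 * K + N * r) / t := by
    rw [hl]; field_simp; ring
  rw [he, Real.exp_add] at total
  -- This bound cancels the `N ^ N` in `a ^ N`, so that the top weight `a ^ N / N!` is at least `1 /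
  -- (s t) ^ N`.
  have hf : ((M + 1).factorial : ℝ) ≤ N ^ (M + 1) := by
    rw [hN]; exact_mod_cast Nat.factorial_le_pow (M + 1)
  set Y := Real.exp (N * c 1) * Real.exp ((N ^ 2 * K + N * r) / t) with hY
  have hls : (l / s) ^ (M + 1) = N ^ (M + 1) / (s * t) ^ (M + 1) := by
    rw [← div_pow, hl]; congr 1; field_simp
  have h1 : 1 / (s * t) ^ (M + 1) ≤ (l / s) ^ (M + 1) / ((M + 1).factorial : ℝ) := by
    rw [hls, le_div_iff₀ (by positivity), one_div_mul_eq_div]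
    gcongr
  have h2 := (mul_le_mul_of_nonneg_right h1 (norm_nonneg ((P ^ (M + 1)) ((U ^ t) ξ)))).trans total
  rw [one_div_mul_eq_div, div_le_iff₀ (by positivity)] at h2
  linarith

end WeightedNorm

/-! ### Translations in momentum and difference operators on `ℝ^d` -/

theorem measurableSet_abs_coord_le {d : ℕ} (i : Fin d) (a : ℝ) :
    MeasurableSet {x : EuclideanSpace ℝ (Fin d) | |x i| ≤ a} :=
  measurableSet_le (by fun_prop) (by fun_prop)

theorem measurableSet_le_abs_coord {d : ℕ} (i : Fin d) (a : ℝ) :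
    MeasurableSet {x : EuclideanSpace ℝ (Fin d) | a ≤ |x i|} :=
  measurableSet_le (by fun_prop) (by fun_prop)

namespace SpectralMeasure

section Representation

variable {d : ℕ} {H : Type*} [NormedAddCommGroup H] [InnerProductSpace ℂ H]
  [CompleteSpace H] (E : SpectralMeasure (EuclideanSpace ℝ (Fin d)) H)

theorem isIntegral_rep (k : EuclideanSpace ℝ (Fin d)) :
    E.IsIntegral (fun x => Complex.exp (Complex.I * ((inner ℝ x k : ℝ) : ℂ))) (E.rep k) :=
  E.isIntegral_integral _ _ _

theorem norm_exp_I_mul_inner_le (k x : EuclideanSpace ℝ (Fin d)) :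
    ‖Complex.exp (Complex.I * ((inner ℝ x k : ℝ) : ℂ))‖ ≤ 1 := by
  rw [mul_comm, Complex.norm_exp_ofReal_mul_I]

theorem rep_zero : E.rep 0 = 1 := by
  refine (E.isIntegral_rep 0).unique ?_
  simpa using E.isIntegral_one

theorem rep_add (k l : EuclideanSpace ℝ (Fin d)) : E.rep (k + l) = E.rep k * E.rep l := by
  refine (E.isIntegral_rep (k + l)).unique ?_
  convert (E.isIntegral_rep k).mul (E.isIntegral_rep l) (by fun_prop) (norm_exp_I_mul_inner_le k)
    (by fun_prop) (norm_exp_I_mul_inner_le l) using 2 with x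
  rw [← Complex.exp_add, inner_add_right]
  push_cast
  ring_nf

theorem norm_rep_le_one (k : EuclideanSpace ℝ (Fin d)) : ‖E.rep k‖ ≤ 1 := by
  refine ContinuousLinearMap.opNorm_le_bound _ zero_le_one fun ξ => ?_
  refine (sq_le_sq₀ (norm_nonneg _) (by positivity)).mp ?_
  rw [(E.isIntegral_rep k).norm_apply_sq (by fun_prop) (norm_exp_I_mul_inner_le k)]
  have h : ∀ x : EuclideanSpace ℝ (Fin d),
      ‖Complex.exp (Complex.I * ((inner ℝ x k : ℝ) : ℂ))‖ = 1 := fun x => by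
    rw [mul_comm, Complex.norm_exp_ofReal_mul_I]
  simp [h, E.real_vecMeasure_univ]

/-- The difference operator `v_E(s e_i) - 1`. -/
noncomputable def diffOp (i : Fin d) (s : ℝ) : H →L[ℂ] H :=
  E.rep (s • EuclideanSpace.single i 1) - 1

theorem isIntegral_diffOp (i : Fin d) (s : ℝ) :
    E.IsIntegral (fun x => Complex.exp (Complex.I * ((s * x i : ℝ) : ℂ)) - 1) (E.diffOp i s) := by
  have h1 := E.isIntegral_rep (s • EuclideanSpace.single i 1)
  have h := h1.add (E.isIntegral_one.const_mul (-1))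
    (E.integrable_of_bounded (by fun_prop) (norm_exp_I_mul_inner_le _))
    (fun ξ => integrable_const _)
  rw [diffOp]
  convert h using 2 with x
  · simp [inner_smul_right, EuclideanSpace.inner_single_right, sub_eq_add_neg]
  · simp [sub_eq_add_neg]

theorem norm_diffOp_symbol_le_two (i : Fin d) (s : ℝ) (x : EuclideanSpace ℝ (Fin d)) :
    ‖Complex.exp (Complex.I * ((s * x i : ℝ) : ℂ)) - 1‖ ≤ 2 := by
  refine (norm_sub_le _ _).trans ?_
  rw [mul_comm, Complex.norm_exp_ofReal_mul_I, norm_one]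
  norm_num

theorem norm_diffOp_pow_apply_le (i : Fin d) {s r : ℝ} (hs : 0 ≤ s) (hr : 0 ≤ r) {ξ : H}
    (hξ : E.proj {x | |x i| ≤ r} ξ = ξ) (n : ℕ) :
    ‖(E.diffOp i s ^ n) ξ‖ ≤ (s * r) ^ n * ‖ξ‖ := by
  refine (E.isIntegral_diffOp i s).norm_pow_apply_le (by fun_prop)
    (norm_diffOp_symbol_le_two i s) (measurableSet_abs_coord_le i r)
    (by positivity) (fun x hx => ?_) n hξ
  refine Real.norm_exp_I_mul_ofReal_sub_one_le.trans ?_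
  rw [norm_mul, Real.norm_of_nonneg hs]
  exact mul_le_mul_of_nonneg_left hx hs

/-- Chebyshev's inequality with `|exp(iθ) - 1| = 2 |sin (θ/2)| ≥ (2/π) |θ|` for `|θ| ≤ π`.
Periodicity of the symbol is what forces the upper cutoff `b`. -/
theorem le_norm_diffOp_pow_apply (i : Fin d) {s a b : ℝ} (hs : 0 ≤ s) (ha : 0 ≤ a)
    (hb : s * b ≤ Real.pi) (n : ℕ) (ξ : H) :
    (2 / Real.pi * (s * a)) ^ n * ‖E.proj {x | a ≤ |x i| ∧ |x i| ≤ b} ξ‖ ≤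
      ‖(E.diffOp i s ^ n) ξ‖ := by
  have hpi := Real.pi_pos
  refine (E.isIntegral_diffOp i s).le_norm_pow_apply (by fun_prop)
    (norm_diffOp_symbol_le_two i s) ((measurableSet_le_abs_coord i a).inter
      (measurableSet_abs_coord_le i b))
    (by positivity) (fun x hx => ?_) n ξ
  obtain ⟨hx1, hx2⟩ := hx
  have hsx : |s * x i / 2| = s * |x i| / 2 := by
    rw [abs_div, abs_mul, abs_of_nonneg hs, abs_two]
  have h1 : s * |x i| ≤ s * b := mul_le_mul_of_nonneg_left hx2 hs
  have h2 : s * a ≤ s * |x i| := mul_le_mul_of_nonneg_left hx1 hs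
  have h3 := Real.mul_abs_le_abs_sin (x := s * x i / 2) (by rw [hsx]; linarith)
  rw [Complex.norm_exp_I_mul_ofReal_sub_one, norm_mul, Real.norm_ofNat, Real.norm_eq_abs]
  rw [hsx] at h3
  have h4 : 2 / Real.pi * (s * a) ≤ 2 / Real.pi * (s * |x i|) :=
    mul_le_mul_of_nonneg_left h2 (by positivity)
  linarith

theorem norm_proj_iUnion_le {X : Type*} [MeasurableSpace X] (E : SpectralMeasure X H)
    {f : ℕ → Set X} (hf : ∀ n, MeasurableSet (f n)) (hm : Monotone f) {ξ : H} {C : ℝ}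
    (hC : ∀ n, ‖E.proj (f n) ξ‖ ≤ C) : ‖E.proj (⋃ n, f n) ξ‖ ≤ C := by
  have h := tendsto_measure_iUnion_atTop (μ := E.vecMeasure ξ) hm
  have h2 := (ENNReal.tendsto_toReal (measure_ne_top _ _)).comp h
  have h3 : (E.vecMeasure ξ).real (⋃ n, f n) ≤ C ^ 2 := by
    refine le_of_tendsto' h2 fun n => ?_
    change (E.vecMeasure ξ).real (f n) ≤ C ^ 2
    rw [E.real_vecMeasure_eq_norm_sq ξ (hf n)]
    exact pow_le_pow_left₀ (norm_nonneg _) (hC n) 2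
  rw [E.real_vecMeasure_eq_norm_sq ξ (MeasurableSet.iUnion hf)] at h3
  exact (sq_le_sq₀ (norm_nonneg _) ((norm_nonneg _).trans (hC 0))).mp h3

/-- The constants come from the derivatives of `x ↦ v_E(x e_i) U v_E(-x e_i)` and serve all steps `s
≤ 1` at once, which later permits `s → 0`. -/
theorem exists_leibniz_bound {U : H →L[ℂ] H} (hU : ‖U‖ ≤ 1) (h : IsSmoothMorphism E E U)
    (i : Fin d) : ∃ c : ℕ → ℝ, (∀ n, 0 ≤ c n) ∧ c 0 = 1 ∧ ∀ s : ℝ, 0 < s → s ≤ 1 → ∀ n ξ,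
      ‖(E.diffOp i s ^ n) (U ξ)‖ ≤ ∑ p ∈ Finset.HasAntidiagonal.antidiagonal n,
        (n.choose p.1 : ℝ) * (c p.1 * s ^ p.1 * ‖(E.diffOp i s ^ p.2) ξ‖) := by
  set e : EuclideanSpace ℝ (Fin d) := EuclideanSpace.single i 1
  set W : ℝ → (H →L[ℂ] H) := fun x => E.rep (x • e) * (U * E.rep (-(x • e))) with hW
  have hWs : ContDiff ℝ ∞ W :=
    ContDiff.comp (g := fun k : EuclideanSpace ℝ (Fin d) => E.rep k ∘L U ∘L E.rep (-k)) h
      (contDiff_id.smul contDiff_const)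
  have hW0 : W 0 = U := by simp [hW, E.rep_zero]
  choose C hC0 hC using fun n => hWs.exists_norm_fwdDiff_iter_le n
  -- The zeroth constant must be exactly `1`, since a larger one would grow exponentially over `t`
  -- steps; `‖U‖ ≤ 1` permits this.
  refine ⟨fun n => if n = 0 then 1 else C n, fun n => ?_, if_pos rfl, fun s hs hs1 n ξ => ?_⟩
  · dsimp only
    split_ifs
    exacts [zero_le_one, hC0 n]
  have heq : ∀ x, E.rep (s • e) * W x = W (x + s) * E.rep (s • e) := fun x => by
    have h1 : E.rep (-((x + s) • e)) * E.rep (s • e) = E.rep (-(x • e)) := by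
      rw [← E.rep_add]; congr 1; module
    have h2 : E.rep (s • e) * E.rep (x • e) = E.rep ((x + s) • e) := by
      rw [← E.rep_add]; congr 1; module
    simp only [hW]
    rw [mul_assoc, mul_assoc, h1, ← mul_assoc, h2]
  have hL := congrArg (fun T : H →L[ℂ] H => T ξ) (sub_one_pow_mul_eq_sum (E.rep (s • e)) U n)
  simp only [mul_apply_eq_comp, sum_apply, smul_apply] at hL
  change (E.diffOp i s ^ n) (U ξ) = _ at hL
  rw [hL]
  refine (norm_sum_le _ _).trans (Finset.sum_le_sum fun p _ => ?_)
  rw [norm_smul, Real.norm_natCast]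
  refine mul_le_mul_of_nonneg_left ((ContinuousLinearMap.le_opNorm _ _).trans
    (mul_le_mul_of_nonneg_right ?_ (norm_nonneg _))) (by positivity)
  dsimp only
  split_ifs with hp
  · simpa [hp] using hU
  · rw [← hW0, commutator_iter_eq_fwdDiff_iter heq]
    refine (norm_mul_le _ _).trans ?_
    have h3 : ‖E.rep (s • e) ^ p.1‖ ≤ 1 :=
      (norm_pow_le' _ (Nat.pos_of_ne_zero hp)).trans (pow_le_one₀ (norm_nonneg _)
        (E.norm_rep_le_one _))
    exact (mul_le_of_le_one_right (norm_nonneg _) h3).trans (hC p.1 s ⟨hs.le, hs1⟩)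

end Representation

end SpectralMeasure

/-! ### Finite speed of propagation in one coordinate -/

namespace SpectralMeasure

variable {d : ℕ} {H : Type*} [NormedAddCommGroup H] [InnerProductSpace ℂ H]
  [CompleteSpace H] (E : SpectralMeasure (EuclideanSpace ℝ (Fin d)) H)

theorem tendsto_proj_abs_le (i : Fin d) (ξ : H) :
    Tendsto (fun n : ℕ => E.proj {x | |x i| ≤ (n : ℝ)} ξ) atTop (𝓝 ξ) := by
  have hms : ∀ n : ℕ, MeasurableSet {x : EuclideanSpace ℝ (Fin d) | |x i| ≤ (n : ℝ)} := fun n =>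
    measurableSet_abs_coord_le i n
  have hm : Monotone fun n : ℕ => {x : EuclideanSpace ℝ (Fin d) | |x i| ≤ (n : ℝ)} :=
    fun m n hmn x (hx : |x i| ≤ m) => hx.trans (Nat.cast_le.mpr hmn)
  have hu : (⋃ n : ℕ, {x : EuclideanSpace ℝ (Fin d) | |x i| ≤ (n : ℝ)}) = Set.univ :=
    Set.eq_univ_of_forall fun x => Set.mem_iUnion.mpr (exists_nat_ge |x i|)
  have h1 := tendsto_measure_iUnion_atTop (μ := E.vecMeasure ξ) hm
  rw [hu] at h1
  have h2 := (ENNReal.tendsto_toReal (measure_ne_top _ _)).comp h1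
  rw [← Measure.real, E.real_vecMeasure_univ] at h2
  have h3 := (h2.const_sub (‖ξ‖ ^ 2)).sqrt
  rw [sub_self, Real.sqrt_zero] at h3
  rw [tendsto_iff_norm_sub_tendsto_zero]
  refine h3.congr fun n => ?_
  have h4 : (E.vecMeasure ξ).real {x | |x i| ≤ (n : ℝ)} + ‖E.proj {x | |x i| ≤ (n : ℝ)}ᶜ ξ‖ ^ 2 =
      ‖ξ‖ ^ 2 := by
    rw [← E.real_vecMeasure_eq_norm_sq ξ (hms n).compl, measureReal_add_measureReal_compl (hms n),
      E.real_vecMeasure_univ]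
  have h5 : E.proj {x | |x i| ≤ (n : ℝ)} ξ - ξ = -E.proj {x | |x i| ≤ (n : ℝ)}ᶜ ξ := by
    have := congrArg (fun T : H →L[ℂ] H => T ξ) (E.proj_add_proj_compl (hms n))
    simp only [add_apply, one_apply_eq_self] at this
    rw [← sub_eq_zero, sub_neg_eq_add, sub_add_eq_add_sub, this, sub_self]
  rw [h5, norm_neg]
  have h6 : ‖ξ‖ ^ 2 - (E.vecMeasure ξ).real {x | |x i| ≤ (n : ℝ)} =
      ‖E.proj {x | |x i| ≤ (n : ℝ)}ᶜ ξ‖ ^ 2 := by linarith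
  exact (congrArg Real.sqrt h6).trans (Real.sqrt_sq (norm_nonneg _))

/-- The `i`-th coordinate of a smooth discrete-time evolution propagates with finite speed: at time
`t` the part of the wave function outside `|x_i| ≤ R t` is smaller than every power `2^{-N}`. -/
theorem exists_speed_bound {U : H →L[ℂ] H} (hU : ‖U‖ ≤ 1) (h : IsSmoothMorphism E E U)
    (i : Fin d) : ∃ R : ℝ, ∀ r : ℝ, 0 ≤ r → ∀ M : ℕ, ∃ K : ℝ, ∀ t : ℕ, M + 1 ≤ t → ∀ ξ : H,
      E.proj {x | |x i| ≤ r} ξ = ξ →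
      ‖E.proj {x | R * t ≤ |x i|} ((U ^ t) ξ)‖ ≤ (1 / 2) ^ (M + 1) * Real.exp (K / t) * ‖ξ‖ := by
  obtain ⟨c, hc, hc0, hL⟩ := E.exists_leibniz_bound hU h i
  have hpi := Real.pi_pos
  -- With this `R`, the factor `(2/π) s R t` of the lower bound is twice the growth factor `s t exp
  -- (c 1)` of the upper bound; their quotient yields `1 / 2` per power.
  refine ⟨Real.pi * Real.exp (c 1), fun r hr M =>
    ⟨(M + 1) ^ 2 * (∑ n ∈ Finset.range M, c (n + 2)) + (M + 1) * r, fun t ht ξ hξ => ?_⟩⟩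
  set R := Real.pi * Real.exp (c 1) with hR
  have hRpos : 0 < R := by positivity
  have ht0 : (0 : ℝ) < t := by exact_mod_cast (Nat.succ_pos M).trans_le ht
  set K : ℝ := (M + 1) ^ 2 * (∑ n ∈ Finset.range M, c (n + 2)) + (M + 1) * r
  have hU' : {x : EuclideanSpace ℝ (Fin d) | R * t ≤ |x i|} =
      ⋃ n : ℕ, {x : EuclideanSpace ℝ (Fin d) | R * t ≤ |x i| ∧ |x i| ≤ (n : ℝ)} := by
    ext x
    simp only [Set.mem_ofPred_eq, Set.mem_iUnion, exists_and_left]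
    exact ⟨fun hx => ⟨hx, exists_nat_ge _⟩, fun hx => hx.1⟩
  -- The symbol bound needs `s |x_i| ≤ π`, so the region is exhausted by `|x_i| ≤ n`, with `s`
  -- shrinking as `n` grows. The estimate obtained is free of `s`, so it passes to the union.
  rw [hU']
  refine E.norm_proj_iUnion_le (fun n => (measurableSet_le_abs_coord i _).inter
      (measurableSet_abs_coord_le i _))
    (fun m n hmn x (hx : _ ∧ |x i| ≤ (m : ℝ)) =>
      ⟨hx.1, hx.2.trans (Nat.cast_le.mpr hmn)⟩) fun n => ?_
  set s : ℝ := 1 / (n + 1) with hs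
  have hs0 : 0 < s := by positivity
  have hs1 : s ≤ 1 := by
    rw [hs, div_le_one (by positivity)]
    linarith [(Nat.cast_nonneg n : (0 : ℝ) ≤ n)]
  have hsn : s * n ≤ Real.pi := by
    have : s * n ≤ 1 := by
      rw [hs, one_div_mul_eq_div, div_le_one (by positivity)]
      linarith
    linarith [Real.pi_gt_three]
  have h1 := E.le_norm_diffOp_pow_apply i (a := R * t) hs0.le (by positivity) hsn (M + 1)
    ((U ^ t) ξ)
  have h2 := norm_pow_apply_pow_apply_le hs0 hc hc0 (hL s hs0 hs1) hr
    (E.norm_diffOp_pow_apply_le i hs0.le hr hξ) M t ht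
  have h3 := h1.trans h2
  have h4 : 2 / Real.pi * (s * (R * t)) = 2 * Real.exp (c 1) * (s * t) := by
    rw [hR]; field_simp
  have h5 : Real.exp (((M : ℝ) + 1) * c 1) = Real.exp (c 1) ^ (M + 1) := by
    rw [← Real.exp_nat_mul]; push_cast; rfl
  rw [h4, h5, mul_pow, mul_pow] at h3
  set y := ‖E.proj {x | R * t ≤ |x i| ∧ |x i| ≤ (n : ℝ)} ((U ^ t) ξ)‖
  have h6 : (s * t) ^ (M + 1) * Real.exp (c 1) ^ (M + 1) * (2 ^ (M + 1) * y) ≤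
      (s * t) ^ (M + 1) * Real.exp (c 1) ^ (M + 1) * (Real.exp (K / t) * ‖ξ‖) := by
    linarith
  have h7 := le_of_mul_le_mul_left h6 (by positivity)
  change y ≤ _
  rw [div_pow, one_pow, mul_assoc, one_div_mul_eq_div, le_div_iff₀ (by positivity)]
  linarith

/-- Outside of the region `|x_i| ≤ R t` a smooth discrete-time evolution vanishes asymptotically. -/
theorem exists_speed_tendsto {U : H →L[ℂ] H} (hU : ‖U‖ ≤ 1) (h : IsSmoothMorphism E E U)
    (i : Fin d) : ∃ R : ℝ, ∀ ξ : H,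
      Tendsto (fun t : ℕ => ‖E.proj {x | R * t ≤ |x i|} ((U ^ t) ξ)‖) atTop (𝓝 0) := by
  obtain ⟨R, hR⟩ := E.exists_speed_bound hU h i
  refine ⟨R, fun ξ => ?_⟩
  have hms : ∀ t : ℕ, MeasurableSet {x : EuclideanSpace ℝ (Fin d) | R * t ≤ |x i|} := fun t =>
    measurableSet_le_abs_coord i _
  rw [Metric.tendsto_atTop]
  intro ε hε
  -- Replacing `ξ` by its truncation to `|x_i| ≤ n` costs at most `ε / 2` at all times, because
  -- powers of `U` and the projections are contractions.
  obtain ⟨n, hn⟩ := (Metric.tendsto_atTop.mp (E.tendsto_proj_abs_le i ξ) (ε / 2)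
    (half_pos hε)).imp fun n hn => hn n le_rfl
  set η := E.proj {x | |x i| ≤ (n : ℝ)} ξ with hη
  have hηη : E.proj {x | |x i| ≤ (n : ℝ)} η = η :=
    E.proj_proj (measurableSet_abs_coord_le i _) ξ
  -- The power `M` is fixed before `t`: the factor `2` anticipates `exp (K / t) < 2` for large `t`,
  -- where `K` depends on `M` and `n` only.
  obtain ⟨M, hM⟩ : ∃ M : ℕ, (1 / 2 : ℝ) ^ (M + 1) * 2 * ‖η‖ < ε / 2 := by
    have : Tendsto (fun M : ℕ => (1 / 2 : ℝ) ^ (M + 1) * 2 * ‖η‖) atTop (𝓝 (0 * 2 * ‖η‖)) :=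
      (((tendsto_pow_atTop_nhds_zero_of_lt_one (by norm_num) (by norm_num)).comp
        (tendsto_add_atTop_nat 1)).mul_const 2).mul_const ‖η‖
    rw [zero_mul, zero_mul] at this
    exact (this.eventually (gt_mem_nhds (half_pos hε))).exists
  obtain ⟨K, hK⟩ := hR n (Nat.cast_nonneg n) M
  have hexp : ∀ᶠ t : ℕ in atTop, Real.exp (K / t) < 2 := by
    have : Tendsto (fun t : ℕ => Real.exp (K / t)) atTop (𝓝 (Real.exp 0)) :=
      (Real.continuous_exp.tendsto 0).comp (tendsto_const_div_atTop_nhds_zero_nat K)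
    rw [Real.exp_zero] at this
    exact this.eventually (gt_mem_nhds one_lt_two)
  obtain ⟨T, hT⟩ := eventually_atTop.mp (hexp.and (eventually_ge_atTop (M + 1)))
  refine ⟨T, fun t ht => ?_⟩
  obtain ⟨ht1, ht2⟩ := hT t ht
  rw [dist_zero_right, norm_norm]
  have h1 := hK t ht2 η hηη
  have hUt : ‖(U ^ t) (ξ - η)‖ ≤ ‖ξ - η‖ := by
    refine ((U ^ t).le_opNorm _).trans (mul_le_of_le_one_left (norm_nonneg _) ?_)
    rcases t.eq_zero_or_pos with rfl | htp
    · omega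
    · exact (norm_pow_le' U htp).trans (pow_le_one₀ (norm_nonneg _) hU)
  have h2 : ‖E.proj {x | R * t ≤ |x i|} ((U ^ t) (ξ - η))‖ < ε / 2 :=
    ((E.norm_proj_apply_le (hms t) _).trans hUt).trans_lt (by
      rwa [dist_comm, dist_eq_norm] at hn)
  have h3 : ‖E.proj {x | R * t ≤ |x i|} ((U ^ t) η)‖ < ε / 2 := by
    refine (h1.trans ?_).trans_lt hM
    gcongr
  calc _ = ‖E.proj {x | R * t ≤ |x i|} ((U ^ t) (ξ - η)) +
        E.proj {x | R * t ≤ |x i|} ((U ^ t) η)‖ := by rw [← map_add, ← map_add, sub_add_cancel]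
    _ < ε := (norm_add_le _ _).trans_lt (by linarith)

end SpectralMeasure

/-! ### Boxes and the velocity distribution -/

theorem isBounded_setOf_abs_le {d : ℕ} (R : Fin d → ℝ) :
    Bornology.IsBounded {x : EuclideanSpace ℝ (Fin d) | ∀ i, |x i| ≤ R i} := by
  refine isBounded_iff_forall_norm_le.mpr ⟨√(∑ i, R i ^ 2), fun x hx => ?_⟩
  rw [EuclideanSpace.norm_eq]
  refine Real.sqrt_le_sqrt (Finset.sum_le_sum fun i _ => ?_)
  rw [Real.norm_eq_abs]
  exact pow_le_pow_left₀ (abs_nonneg _) (hx i) 2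

theorem isClosed_setOf_abs_le {d : ℕ} (R : Fin d → ℝ) :
    IsClosed {x : EuclideanSpace ℝ (Fin d) | ∀ i, |x i| ≤ R i} := by
  rw [Set.ofPred_forall]
  exact isClosed_iInter fun i => isClosed_le (by fun_prop) continuous_const

namespace QuantumWalk

variable {d : ℕ} {H : Type*} [NormedAddCommGroup H] [InnerProductSpace ℂ H] [CompleteSpace H]

theorem evol_natCast (Q : QuantumWalk d H) (t : ℕ) : Q.evol t = (Q.evol 1) ^ t := by
  simp [evol]

theorem norm_evol_apply (Q : QuantumWalk d H) (t : ℤ) (ξ : H) : ‖Q.evol t ξ‖ = ‖ξ‖ :=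
  Unitary.norm_map (Q.U ^ t) ξ

theorem norm_evol_le_one (Q : QuantumWalk d H) (t : ℤ) : ‖Q.evol t‖ ≤ 1 :=
  ContinuousLinearMap.opNorm_le_bound _ zero_le_one fun ξ => by rw [Q.norm_evol_apply, one_mul]

/-- Union bound: if `x / t` leaves the box, then `|x_i| > R i * t` for some `i`. -/
theorem one_sub_sum_le_real_velocity (Q : QuantumWalk d H) (R : Fin d → ℝ) {t : ℕ} (ht : 0 < t)
    {ξ : H} (hξ : ‖ξ‖ = 1) :
    1 - ∑ i, ‖Q.E.proj {x | R i * t ≤ |x i|} (Q.evol t ξ)‖ ^ 2 ≤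
      (Q.velocity t ξ).real {x | ∀ i, |x i| ≤ R i} := by
  have ht0 : (0 : ℝ) < t := by exact_mod_cast ht
  have hΩ := (isClosed_setOf_abs_le R).measurableSet
  have hf : Measurable fun x : EuclideanSpace ℝ (Fin d) => (t : ℝ)⁻¹ • x := by fun_prop
  rw [velocity, map_measureReal_apply hf hΩ]
  set μ := Q.E.vecMeasure (Q.evol t ξ)
  set A := (fun x : EuclideanSpace ℝ (Fin d) => (t : ℝ)⁻¹ • x) ⁻¹' {x | ∀ i, |x i| ≤ R i}
  have h1 : μ.real A + μ.real Aᶜ = 1 := by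
    rw [measureReal_add_measureReal_compl (hf hΩ), Q.E.real_vecMeasure_univ, Q.norm_evol_apply, hξ,
      one_pow]
  have h2 : Aᶜ ⊆ ⋃ i, {x : EuclideanSpace ℝ (Fin d) | R i * t ≤ |x i|} := by
    intro x hx
    simp only [A, Set.mem_compl_iff, Set.mem_preimage, Set.mem_ofPred_eq, not_forall, not_le,
      PiLp.smul_apply, smul_eq_mul, abs_mul, abs_inv, Nat.abs_cast] at hx
    obtain ⟨i, hi⟩ := hx
    rw [lt_inv_mul_iff₀ ht0] at hi
    exact Set.mem_iUnion.mpr ⟨i, by rw [Set.mem_ofPred_eq]; linarith⟩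
  have h3 : μ.real Aᶜ ≤ ∑ i, ‖Q.E.proj {x | R i * t ≤ |x i|} (Q.evol t ξ)‖ ^ 2 := by
    refine (measureReal_mono h2).trans ((measureReal_iUnion_fintype_le _).trans_eq
      (Finset.sum_congr rfl fun i _ => ?_))
    exact Q.E.real_vecMeasure_eq_norm_sq _ (measurableSet_le_abs_coord i _)
  linarith

theorem velocity_le_one (Q : QuantumWalk d H) (t : ℕ) {ξ : H} (hξ : ‖ξ‖ = 1)
    {s : Set (EuclideanSpace ℝ (Fin d))} (hs : MeasurableSet s) : Q.velocity t ξ s ≤ 1 := by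
  rw [velocity, Measure.map_apply (by fun_prop) hs]
  refine (measure_mono (Set.subset_univ _)).trans ?_
  rw [Q.E.vecMeasure_univ, Q.norm_evol_apply, hξ]
  simp

end QuantumWalk

theorem mainTheorem2 (d : ℕ) {H : Type*} [NormedAddCommGroup H] [InnerProductSpace ℂ H]
    [CompleteSpace H] (Q : QuantumWalk d H) (hQ : Q.IsSmooth) :
    ∃ Ω : Set (EuclideanSpace ℝ (Fin d)), Bornology.IsBounded Ω ∧ IsClosed Ω ∧
      ∀ ξ : H, ‖ξ‖ = 1 → Tendsto (fun t : ℕ => Q.velocity t ξ Ω) atTop (𝓝 1) := by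
  -- The half-widths are fixed before any `ξ`, so a single box serves all unit vectors.
  choose R hR using fun i => Q.E.exists_speed_tendsto (Q.norm_evol_le_one 1) (hQ 1) i
  refine ⟨{x | ∀ i, |x i| ≤ R i}, isBounded_setOf_abs_le R, isClosed_setOf_abs_le R,
    fun ξ hξ => ?_⟩
  have hsum : Tendsto (fun t : ℕ => ENNReal.ofReal
      (1 - ∑ i, ‖Q.E.proj {x | R i * t ≤ |x i|} (Q.evol t ξ)‖ ^ 2)) atTop (𝓝 1) := by
    have h1 : Tendsto (fun t : ℕ => 1 - ∑ i, ‖Q.E.proj {x | R i * t ≤ |x i|} (Q.evol t ξ)‖ ^ 2)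
        atTop (𝓝 (1 - ∑ _i : Fin d, (0 : ℝ) ^ 2)) := by
      refine tendsto_const_nhds.sub (tendsto_finsetSum _ fun i _ => ?_)
      simp only [Q.evol_natCast]
      exact (hR i ξ).pow 2
    simpa using ENNReal.tendsto_ofReal h1
  refine tendsto_of_tendsto_of_tendsto_of_le_of_le' hsum tendsto_const_nhds ?_
    (Eventually.of_forall fun t => Q.velocity_le_one t hξ (isClosed_setOf_abs_le R).measurableSet)
  filter_upwards [eventually_gt_atTop 0] with t ht
  refine (ENNReal.ofReal_le_ofReal (Q.one_sub_sum_le_real_velocity R ht hξ)).trans ?_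
  exact ENNReal.ofReal_toReal_le
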